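/- Let $E$ be a finite-dimensional complex normed space (that is, $\mathbb{C}^n$ with an arbitrary norm), with open unit ball $B$ and unit sphere $S$, and let $H^\infty(B)$ be the algebra of bounded holomorphic functions $f\colon B\to\mathbb{C}$ with the supremum norm. For $f\in H^\infty(B)$ and $x\in S$ let $$rCl(f,x)=\Bigl\{\mu\in\mathbb{C} : \text{there is a sequence } (t_k)\subset(0,1) \text{ with } t_k\to 1 \text{ and } f(t_kx)\to\mu\Bigr\}$$ be the radial cluster set of $f$ at $x$. Let $M\subset S$ be a non-empty countable (finite or infinite) set, and let $\mathcal{F}$ be the set of all $f\in H^\infty(B)$ for which there is a disc $\mathbf{D}\subset\mathbb{C}$ of positive radius with $$\mathbf{D}\subset\bigcap_{z\in M} rCl(f,z).$$ Then: (I) $\mathcal{F}\cup\{0\}$ contains an isomorphic copy of the complex Banach space $\ell_1$, that is, a linear subspace of $H^\infty(B)$ which is linearly homeomorphic to $\ell_1$. In particular $\mathcal{F}$ is spaceable: $\mathcal{F}\cup\{0\}$ contains a closed infinite-dimensional linear subspace of $H^\infty(B)$. (II) $\mathcal{F}$ is pointwise strongly $\mathfrak{c}$-algebrable: $\mathcal{F}$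 is non-empty and for every $f\in\mathcal{F}$ there is a set $G\subset H^\infty(B)$ of cardinality $\mathfrak{c}$, algebraically independent over $\mathbb{C}$, such that the subalgebra $\mathcal{B}$ generated by $G$ satisfies $f\in\mathcal{B}\subset\mathcal{F}\cup\{0\}$. In particular $\mathcal{F}$ is strongly $\mathfrak{c}$-algebrable: $\mathcal{F}\cup\{0\}$ contains a subalgebra of $H^\infty(B)$ generated by an algebraically independent set of cardinality $\mathfrak{c}$. Here subalgebras are not required to contain the constants, so the subalgebra generated by $G$ consists of all values at elements of $G$ of complex polynomials without constant term. -/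

import Mathlib

open Metric Filter Topology Cardinal
open scoped BoundedContinuousFunction

noncomputable section

/-- The algebra `H^∞(B)` of bounded holomorphic functions on the open unit ball `B` of `E`, as a
subalgebra of the algebra of bounded continuous functions on `B` with the supremum norm. A function
on `B` is holomorphic if it is the restriction to `B` of some `F : E → ℂ` (with no condition
outside the open set `B`) which is complex differentiable at every point of `B`. -/
def HInfty (E : Type*) [NormedAddCommGroup E] [NormedSpace ℂ E] :
    Subalgebra ℂ (ball (0 : E) 1 →ᵇ ℂ) where
  carrier := {f | ∃ F : E → ℂ, DifferentiableOn ℂ F (ball (0 : E) 1) ∧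
    ∀ x : ball (0 : E) 1, F x = f x}
  mul_mem' := by
    rintro f g ⟨F, hF, hf⟩ ⟨G, hG, hg⟩
    exact ⟨fun x => F x * G x, hF.mul hG, fun x => by simp [hf, hg]⟩
  add_mem' := by
    rintro f g ⟨F, hF, hf⟩ ⟨G, hG, hg⟩
    exact ⟨fun x => F x + G x, hF.add hG, fun x => by simp [hf, hg]⟩
  algebraMap_mem' := fun c => ⟨fun _ => c, differentiableOn_const c, fun _ => rfl⟩

section Radial

variable {E : Type*} [NormedAddCommGroup E] [NormedSpace ℂ E]

/-- The point `t x` of the open unit ball, for `x` in the unit sphere and `0 < t < 1`. -/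
def radialPoint (x : sphere (0 : E) 1) (t : Set.Ioo (0 : ℝ) 1) : ball (0 : E) 1 :=
  ⟨((t : ℝ) : ℂ) • (x : E), by
    have hx : ‖(x : E)‖ = 1 := by simp
    rw [mem_ball_zero_iff, norm_smul, hx, mul_one, Complex.norm_real,
      Real.norm_of_nonneg t.2.1.le]
    exact t.2.2⟩

/-- The radial cluster set of `f ∈ H^∞(B)` at the point `x` of the unit sphere. -/
def radialClusterSet (f : HInfty E) (x : sphere (0 : E) 1) : Set ℂ :=
  {μ | ∃ t : ℕ → Set.Ioo (0 : ℝ) 1,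
    Tendsto (fun k => (t k : ℝ)) atTop (𝓝 1) ∧
    Tendsto (fun k => (f : ball (0 : E) 1 →ᵇ ℂ) (radialPoint x (t k))) atTop (𝓝 μ)}

/-- The set `𝓕` of all `f ∈ H^∞(B)` for which there is a (nondegenerate) disc contained in the
radial cluster set of `f` at every point of `M`. -/
def largeClusterFunctions (M : Set (sphere (0 : E) 1)) : Set (HInfty E) :=
  {f | ∃ (c : ℂ) (r : ℝ), 0 < r ∧ closedBall c r ⊆ ⋂ z ∈ M, radialClusterSet f z}

end Radial

/-- `C ∪ {0}` contains an isomorphic copy of the complex Banach space `ℓ₁`: a linear subspace that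
is linearly homeomorphic to `ℓ₁`. -/
def ContainsCopyOfEllOne {V : Type*} [NormedAddCommGroup V] [NormedSpace ℂ V] (C : Set V) : Prop :=
  ∃ W : Submodule ℂ V, Nonempty (lp (fun _ : ℕ => ℂ) 1 ≃L[ℂ] W) ∧ (W : Set V) ⊆ C ∪ {0}

/-- `C ∪ {0}` contains a closed infinite-dimensional linear subspace. -/
def Spaceable {V : Type*} [NormedAddCommGroup V] [NormedSpace ℂ V] (C : Set V) : Prop :=
  ∃ W : Submodule ℂ V, IsClosed (W : Set V) ∧ ¬ FiniteDimensional ℂ W ∧ (W : Set V) ⊆ C ∪ {0}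

/-- `C ∪ {0}` contains a subalgebra generated by an algebraically independent set of cardinality
`κ`. Subalgebras need not contain the unit: the one generated by `G` consists of the values at
elements of `G` of the polynomials without constant term. -/
def StronglyAlgebrable {A : Type*} [CommRing A] [Algebra ℂ A] (κ : Cardinal) (C : Set A) : Prop :=
  ∃ G : Set A, #G = κ ∧ AlgebraicIndependent ℂ ((↑) : G → A) ∧
    (NonUnitalAlgebra.adjoin ℂ G : Set A) ⊆ C ∪ {0}

/-- `C` is non-empty and each of its elements lies in a subalgebra contained in `C ∪ {0}` and
generated by an algebraically independent set of cardinality `κ`. -/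
def PointwiseStronglyAlgebrable {A : Type*} [CommRing A] [Algebra ℂ A] (κ : Cardinal)
    (C : Set A) : Prop :=
  C.Nonempty ∧ ∀ f ∈ C, ∃ G : Set A, #G = κ ∧ AlgebraicIndependent ℂ ((↑) : G → A) ∧
    f ∈ NonUnitalAlgebra.adjoin ℂ G ∧ (NonUnitalAlgebra.adjoin ℂ G : Set A) ⊆ C ∪ {0}

end

/-! Part (I) comes from approximate interpolation along radii. Choose points `z_k = (1 - nodeGap k)
x_k` with `x_k ∈ M` and norming functionals `φ_k` at `x_k`. Functions `p_k` of `φ_k`, close to `1`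
at `z_k` and tiny at the earlier points, give the recursion `F_{k+1} = (1 - p_k)² F_k + w_k p_k²`.
Its limit is linear in `w`, is bounded by `sup |w_k|`, and differs from `w_k` at `z_k` by
`O(2^{-k})` (`norm_interp_node_sub_le`). For `a ∈ ℓ₁` take `w_k = ∑ a_j v_k(j)`, where the `v_k` run
through a dense set of sequences in the closed unit disc and each pair (point of `M`, dense
sequence) recurs for arbitrarily large `k`. These sums are dense in the disc of radius `‖a‖`
(`exists_ellOnePairing_eq`), so every radial cluster set over `M` contains that disc. This also
forces the map to be isometric.

Part (II) needs only one `f` in the family. By the open mapping theorem `Φ ∘ f` stays in the family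
for every non-constant entire `Φ` (`mem_largeClusterFunctions_of_comp`). The generators are `f` and
`exp (b_i f)` for a Hamel basis `b` of `ℝ` over `ℚ`. A polynomial in them is `Φ ∘ f` with `Φ` a
polynomial in `z` and the `exp (b_i z)`, and comparing growth on the positive real axis shows that
these satisfy no relation (`eq_zero_of_aeval_expFamily`). -/

noncomputable section

/-! ### Differentiability of locally dominated series -/

/-- A sum of holomorphic functions that is dominated by a summable sequence of constants on a ball
is differentiable at the centre. -/
theorem differentiableAt_tsum_of_bound_on_ball {E : Type*} [NormedAddCommGroup E] [NormedSpace ℂ E]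
    {d : ℕ → E → ℂ} {u : ℕ → ℝ} {x : E} {r : ℝ} (hr : 0 < r) (hu : Summable u)
    (hd : ∀ n, DifferentiableOn ℂ (d n) (ball x r)) (hb : ∀ n, ∀ y ∈ ball x r, ‖d n y‖ ≤ u n) :
    DifferentiableAt ℂ (fun y => ∑' n, d n y) x := by
  have hu0 : ∀ n, 0 ≤ u n := fun n => (norm_nonneg _).trans (hb n x (mem_ball_self hr))
  have hat : ∀ n, ∀ y ∈ ball x (r / 2), DifferentiableAt ℂ (d n) y := fun n y hy =>
    (hd n).differentiableAt (isOpen_ball.mem_nhds (ball_subset_ball (by linarith) hy))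
  -- Cauchy's estimate on the complex line `t ↦ y + t v`: a disc of radius `r / 4` around a point of
  -- the half ball stays inside the full ball.
  have key : ∀ n, ∀ y ∈ ball x (r / 2), ‖fderiv ℂ (d n) y‖ ≤ u n / (r / 4) := by
    intro n y hy
    refine ContinuousLinearMap.opNorm_le_of_unit_norm (by have := hu0 n; positivity) fun v hv => ?_
    have hmem : ∀ t : ℂ, ‖t‖ ≤ r / 4 → y + t • v ∈ ball x r := by
      intro t ht
      rw [mem_ball, dist_eq_norm] at hy ⊢
      calc ‖y + t • v - x‖ = ‖(y - x) + t • v‖ := by congr 1; abel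
        _ ≤ ‖y - x‖ + ‖t • v‖ := norm_add_le _ _
        _ < r := by rw [norm_smul, hv]; linarith
    have hline : ∀ t : ℂ, HasDerivAt (fun t : ℂ => y + t • v) v t := fun t => by
      simpa using ((hasDerivAt_id t).smul_const v).const_add y
    have hder : deriv (fun t : ℂ => d n (y + t • v)) 0 = fderiv ℂ (d n) y v := by
      have h0 : HasFDerivAt (d n) (fderiv ℂ (d n) y) (y + (0 : ℂ) • v) := by
        simpa using (hat n y hy).hasFDerivAt
      exact (h0.comp_hasDerivAt (0 : ℂ) (hline 0)).deriv
    rw [← hder]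
    refine Complex.norm_deriv_le_of_forall_mem_sphere_norm_le (by positivity) ?_ ?_
    · refine DifferentiableOn.diffContOnCl_ball (U := closedBall 0 (r / 4)) ?_ le_rfl
      intro t ht
      have ht' := hmem t (by simpa using ht)
      exact ((((hd n).differentiableAt (isOpen_ball.mem_nhds ht')).comp t
        (hline t).differentiableAt)).differentiableWithinAt
    · intro t ht
      exact hb n _ (hmem t (by simpa using (mem_sphere_zero_iff_norm.1 ht).le))
  exact (hasFDerivAt_tsum_of_isPreconnected (𝕜 := ℂ) (hu.div_const (r / 4)) isOpen_ball
    (convex_ball x (r / 2)).isPreconnected (fun n y hy => (hat n y hy).hasFDerivAt) key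
    (mem_ball_self (half_pos hr))
    (hu.of_norm_bounded fun n => hb n x (mem_ball_self hr))
    (mem_ball_self (half_pos hr))).differentiableAt

/-! ### Peak functions and approximate interpolation -/

section Peak

variable {E : Type*} [NormedAddCommGroup E] [NormedSpace ℂ E]

/-- The distance of the `n`-th interpolation point from the unit sphere. -/
def nodeGap (n : ℕ) : ℝ := (1 / 2) ^ ((n + 1) ^ 2)

/-- The width of the `n`-th peak function. -/
def peakWidth (n : ℕ) : ℝ := (1 / 2) ^ (n ^ 2 + n + 1)

theorem nodeGap_pos (n : ℕ) : 0 < nodeGap n := by unfold nodeGap; positivity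

theorem peakWidth_pos (n : ℕ) : 0 < peakWidth n := by unfold peakWidth; positivity

theorem nodeGap_lt_one (n : ℕ) : nodeGap n < 1 :=
  pow_lt_one₀ (by norm_num) (by norm_num) (by positivity)

/-- Together with `peakWidth_le` this separates the scales: the `n`-th width is much larger than the
`n`-th gap and much smaller than every earlier gap. -/
theorem nodeGap_eq (n : ℕ) : nodeGap n = (1 / 2) ^ n * peakWidth n := by
  unfold nodeGap peakWidth
  rw [← pow_add]
  congr 1
  ring

theorem peakWidth_le {m n : ℕ} (h : m < n) : peakWidth n ≤ (1 / 2) ^ (n + 1) * nodeGap m := by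
  unfold nodeGap peakWidth
  rw [← pow_add]
  refine pow_le_pow_of_le_one (by norm_num) (by norm_num) ?_
  have : (m + 1) ^ 2 ≤ n ^ 2 := Nat.pow_le_pow_left h 2
  omega

theorem tendsto_nodeGap : Tendsto nodeGap atTop (𝓝 0) := by
  refine (tendsto_pow_atTop_nhds_zero_of_lt_one (r := (1 / 2 : ℝ)) (by norm_num)
    (by norm_num)).comp ?_
  refine tendsto_atTop_mono (fun n => ?_) tendsto_id
  simp only [id]
  nlinarith

/-- A holomorphic function on the half space `Re φ < 1` which is close to `1` where `φ` is much
closer to `1` than `peakWidth n`, and close to `0` where it is much farther. -/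
def peak (φ : E →L[ℂ] ℂ) (n : ℕ) (z : E) : ℂ :=
  (peakWidth n : ℂ) / (peakWidth n + (1 - φ z))

theorem re_functional_lt_one {φ : E →L[ℂ] ℂ} (hφ : ‖φ‖ ≤ 1) {z : E} (hz : z ∈ ball (0 : E) 1) :
    0 < (1 - φ z).re := by
  have h1 : ‖φ z‖ ≤ ‖z‖ := by simpa using φ.le_of_opNorm_le hφ z
  have h2 := Complex.re_le_norm (φ z)
  have h3 := mem_ball_zero_iff.1 hz
  simp only [Complex.sub_re, Complex.one_re]
  linarith

theorem peak_denom_ne_zero {φ : E →L[ℂ] ℂ} (hφ : ‖φ‖ ≤ 1) (n : ℕ) {z : E}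
    (hz : z ∈ ball (0 : E) 1) : (peakWidth n : ℂ) + (1 - φ z) ≠ 0 := by
  intro h
  have := congrArg Complex.re h
  have h1 := re_functional_lt_one hφ hz
  have h2 := peakWidth_pos n
  rw [Complex.add_re, Complex.ofReal_re, Complex.zero_re] at this
  linarith

theorem differentiableOn_peak {φ : E →L[ℂ] ℂ} (hφ : ‖φ‖ ≤ 1) (n : ℕ) :
    DifferentiableOn ℂ (peak φ n) (ball (0 : E) 1) := by
  unfold peak
  simp only [div_eq_mul_inv]
  refine DifferentiableOn.const_mul (DifferentiableOn.fun_inv ?_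
    fun z hz => peak_denom_ne_zero hφ n hz) _
  exact ((φ.differentiable.const_sub 1).const_add _).differentiableOn

/-- With `a = 1 - φ z` and `δ` the width, `|δ + a|² = δ² + |a|² + 2 δ Re a + (Im a)² - (Im a)²`, and
the cross term is positive since `Re a > 0`. This is why the recursion uses squares: its
coefficients have moduli of sum at most `1`. -/
theorem norm_sq_peak_add_le {φ : E →L[ℂ] ℂ} (hφ : ‖φ‖ ≤ 1) (n : ℕ) {z : E}
    (hz : z ∈ ball (0 : E) 1) : ‖1 - peak φ n z‖ ^ 2 + ‖peak φ n z‖ ^ 2 ≤ 1 := by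
  have hne := peak_denom_ne_zero hφ n hz
  have h1 := re_functional_lt_one hφ hz
  have h2 := peakWidth_pos n
  have e1 : 1 - peak φ n z = (1 - φ z) / (peakWidth n + (1 - φ z)) := by
    unfold peak; field_simp; ring
  rw [e1, peak, norm_div, norm_div, div_pow, div_pow, ← add_div, div_le_one (by positivity)]
  set a := 1 - φ z
  rw [← Complex.normSq_eq_norm_sq, ← Complex.normSq_eq_norm_sq, ← Complex.normSq_eq_norm_sq,
    Complex.normSq_apply, Complex.normSq_apply, Complex.normSq_apply]
  simp only [Complex.add_re, Complex.add_im, Complex.ofReal_re, Complex.ofReal_im]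
  nlinarith [mul_pos h1 h2]

theorem norm_peak_le_one {φ : E →L[ℂ] ℂ} (hφ : ‖φ‖ ≤ 1) (n : ℕ) {z : E}
    (hz : z ∈ ball (0 : E) 1) : ‖peak φ n z‖ ≤ 1 := by
  have := norm_sq_peak_add_le hφ n hz
  nlinarith [sq_nonneg ‖1 - peak φ n z‖, norm_nonneg (peak φ n z)]

theorem norm_one_sub_peak_le_one {φ : E →L[ℂ] ℂ} (hφ : ‖φ‖ ≤ 1) (n : ℕ) {z : E}
    (hz : z ∈ ball (0 : E) 1) : ‖1 - peak φ n z‖ ≤ 1 := by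
  have := norm_sq_peak_add_le hφ n hz
  nlinarith [sq_nonneg ‖peak φ n z‖, norm_nonneg (1 - peak φ n z)]

/-- Here `Re (1 - φ z)` is at least the `m`-th gap, which swamps the `n`-th width. -/
theorem norm_peak_le_of_norm_le {φ : E →L[ℂ] ℂ} (hφ : ‖φ‖ ≤ 1) {m n : ℕ} (hmn : m < n) {z : E}
    (hz : ‖z‖ ≤ 1 - nodeGap m) : ‖peak φ n z‖ ≤ (1 / 2) ^ (n + 1) := by
  have hg := nodeGap_pos m
  have hp := peakWidth_pos n
  have h1 : ‖φ z‖ ≤ ‖z‖ := by simpa using φ.le_of_opNorm_le hφ z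
  have h2 := Complex.re_le_norm (φ z)
  have h3 := Complex.re_le_norm ((peakWidth n : ℂ) + (1 - φ z))
  simp only [Complex.add_re, Complex.sub_re, Complex.one_re, Complex.ofReal_re] at h3
  have h4 : nodeGap m ≤ ‖(peakWidth n : ℂ) + (1 - φ z)‖ := by linarith
  rw [peak, norm_div, Complex.norm_real, Real.norm_of_nonneg hp.le,
    div_le_iff₀ (hg.trans_le h4)]
  exact (peakWidth_le hmn).trans (by gcongr)

theorem norm_one_sub_peak_node_le {φ : E →L[ℂ] ℂ} {n : ℕ} {z : E}
    (hz : φ z = ((1 - nodeGap n : ℝ) : ℂ)) : ‖1 - peak φ n z‖ ≤ (1 / 2) ^ n := by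
  have hg := nodeGap_pos n
  have hp := peakWidth_pos n
  have e : 1 - peak φ n z = ((nodeGap n / (peakWidth n + nodeGap n) : ℝ) : ℂ) := by
    have : ((peakWidth n : ℂ) + nodeGap n) ≠ 0 := by
      rw [← Complex.ofReal_add]; exact Complex.ofReal_ne_zero.2 (by positivity)
    rw [peak, hz]
    push_cast
    rw [show (peakWidth n : ℂ) + (1 - (1 - nodeGap n)) = peakWidth n + nodeGap n by ring]
    field_simp
    ring
  rw [e, Complex.norm_real, Real.norm_of_nonneg (by positivity), div_le_iff₀ (by positivity)]
  nth_rewrite 1 [nodeGap_eq n]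
  gcongr
  linarith

/-- Finite stages of the interpolation. -/
def interpStage (φ : ℕ → E →L[ℂ] ℂ) (w : ℕ → ℂ) : ℕ → E → ℂ
  | 0, _ => 0
  | n + 1, z => (1 - peak (φ n) n z) ^ 2 * interpStage φ w n z + w n * peak (φ n) n z ^ 2

/-- A bounded holomorphic function whose value at the `n`-th node is asymptotically `w n`. -/
def interp (φ : ℕ → E →L[ℂ] ℂ) (w : ℕ → ℂ) (z : E) : ℂ :=
  ∑' n, (interpStage φ w (n + 1) z - interpStage φ w n z)

variable {φ : ℕ → E →L[ℂ] ℂ} {w : ℕ → ℂ} {C : ℝ}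

theorem differentiableOn_interpStage (hφ : ∀ n, ‖φ n‖ ≤ 1) (w : ℕ → ℂ) (n : ℕ) :
    DifferentiableOn ℂ (interpStage φ w n) (ball (0 : E) 1) := by
  induction n with
  | zero => exact differentiableOn_const 0
  | succ n ih =>
    have hp := differentiableOn_peak (hφ n) n
    exact (((hp.const_sub 1).pow 2).mul ih).add ((hp.pow 2).const_mul (w n))

/-- Each stage combines the previous one with `w n` using weights of total modulus at most `1`, so
no constant is lost; the isometry depends on this. -/
theorem norm_interpStage_le (hφ : ∀ n, ‖φ n‖ ≤ 1) (hw : ∀ n, ‖w n‖ ≤ C) (n : ℕ) {z : E}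
    (hz : z ∈ ball (0 : E) 1) : ‖interpStage φ w n z‖ ≤ C := by
  have hC : 0 ≤ C := (norm_nonneg _).trans (hw 0)
  induction n with
  | zero => simpa [interpStage] using hC
  | succ n ih =>
    have h := norm_sq_peak_add_le (hφ n) n hz
    calc ‖interpStage φ w (n + 1) z‖
        ≤ ‖1 - peak (φ n) n z‖ ^ 2 * ‖interpStage φ w n z‖ + ‖w n‖ * ‖peak (φ n) n z‖ ^ 2 := by
          rw [interpStage]
          refine (norm_add_le _ _).trans_eq ?_
          simp only [norm_mul, norm_pow]
      _ ≤ ‖1 - peak (φ n) n z‖ ^ 2 * C + C * ‖peak (φ n) n z‖ ^ 2 := by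
          gcongr
          exact hw n
      _ = C * (‖1 - peak (φ n) n z‖ ^ 2 + ‖peak (φ n) n z‖ ^ 2) := by ring
      _ ≤ C := mul_le_of_le_one_right hC h

theorem norm_interpStage_succ_sub_le (hφ : ∀ n, ‖φ n‖ ≤ 1) (hw : ∀ n, ‖w n‖ ≤ C) (n : ℕ) {z : E}
    (hz : z ∈ ball (0 : E) 1) :
    ‖interpStage φ w (n + 1) z - interpStage φ w n z‖ ≤ 4 * C * ‖peak (φ n) n z‖ := by
  have h1 := norm_peak_le_one (hφ n) n hz
  have h2 := norm_interpStage_le hφ hw n hz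
  have hC : 0 ≤ C := (norm_nonneg _).trans (hw 0)
  have e : interpStage φ w (n + 1) z - interpStage φ w n z =
      peak (φ n) n z * ((peak (φ n) n z - 2) * interpStage φ w n z + w n * peak (φ n) n z) := by
    rw [interpStage]; ring
  have h3 : ‖peak (φ n) n z - 2‖ ≤ 3 := by
    refine (norm_sub_le _ _).trans ?_
    rw [Complex.norm_ofNat]
    linarith
  rw [e, norm_mul, mul_comm]
  gcongr
  calc _ ≤ ‖peak (φ n) n z - 2‖ * ‖interpStage φ w n z‖ + ‖w n‖ * ‖peak (φ n) n z‖ := by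
        refine (norm_add_le _ _).trans_eq ?_
        simp only [norm_mul]
    _ ≤ 3 * C + C * 1 := by
        gcongr
        exact hw n
    _ = 4 * C := by ring

/-- Points of norm at most `1 - nodeGap m` see only small increments after stage `m`. -/
theorem norm_interpStage_succ_sub_le_geometric (hφ : ∀ n, ‖φ n‖ ≤ 1) (hw : ∀ n, ‖w n‖ ≤ C)
    {m n : ℕ} (hmn : m < n) {z : E} (hz : ‖z‖ ≤ 1 - nodeGap m) :
    ‖interpStage φ w (n + 1) z - interpStage φ w n z‖ ≤ 4 * C * (1 / 2) ^ (n + 1) := by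
  have hC : 0 ≤ C := (norm_nonneg _).trans (hw 0)
  have hz1 : z ∈ ball (0 : E) 1 := mem_ball_zero_iff.2 (by linarith [nodeGap_pos m])
  refine (norm_interpStage_succ_sub_le hφ hw n hz1).trans ?_
  gcongr
  exact norm_peak_le_of_norm_le (hφ n) hmn hz

theorem exists_norm_le_one_sub_nodeGap {r : ℝ} (hr : r < 1) : ∃ m, r ≤ 1 - nodeGap m := by
  obtain ⟨m, hm⟩ := (tendsto_nodeGap.eventually (gt_mem_nhds (sub_pos.2 hr))).exists
  exact ⟨m, by linarith⟩

/-- A summable majorant of the increments on the ball of radius `1 - nodeGap m`. -/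
theorem exists_summable_bound (hφ : ∀ n, ‖φ n‖ ≤ 1) (hw : ∀ n, ‖w n‖ ≤ C) (m : ℕ) :
    ∃ u : ℕ → ℝ, Summable u ∧ ∀ n, ∀ z : E, ‖z‖ ≤ 1 - nodeGap m →
      ‖interpStage φ w (n + 1) z - interpStage φ w n z‖ ≤ u n := by
  have hC : 0 ≤ C := (norm_nonneg _).trans (hw 0)
  -- The factor `2 ^ m` covers the indices `n ≤ m`, where only the trivial bound `1` on the peak is
  -- available.
  refine ⟨fun n => 4 * C * 2 ^ m * (1 / 2) ^ n,
    (summable_geometric_of_lt_one (by norm_num) (by norm_num)).mul_left _, fun n z hz => ?_⟩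
  have hz1 : z ∈ ball (0 : E) 1 := mem_ball_zero_iff.2 (by linarith [nodeGap_pos m])
  rcases lt_or_ge m n with h | h
  · refine (norm_interpStage_succ_sub_le_geometric hφ hw h hz).trans ?_
    have h1 : (1 / 2 : ℝ) ^ (n + 1) ≤ (1 / 2) ^ n :=
      pow_le_pow_of_le_one (by norm_num) (by norm_num) (Nat.le_succ n)
    have h2 : (1 : ℝ) ≤ 2 ^ m := one_le_pow₀ (by norm_num)
    have h3 : 4 * C ≤ 4 * C * 2 ^ m := le_mul_of_one_le_right (by positivity) h2
    exact mul_le_mul h3 h1 (by positivity) (by positivity)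
  · refine (norm_interpStage_succ_sub_le hφ hw n hz1).trans ?_
    simp only [mul_assoc (4 * C)]
    gcongr
    refine (norm_peak_le_one (hφ n) n hz1).trans ?_
    calc (1 : ℝ) = 2 ^ n * (1 / 2) ^ n := by rw [← mul_pow]; norm_num
      _ ≤ 2 ^ m * (1 / 2) ^ n := by gcongr; norm_num

theorem hasSum_interp (hφ : ∀ n, ‖φ n‖ ≤ 1) (hw : ∀ n, ‖w n‖ ≤ C) {z : E}
    (hz : z ∈ ball (0 : E) 1) :
    HasSum (fun n => interpStage φ w (n + 1) z - interpStage φ w n z) (interp φ w z) := by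
  obtain ⟨m, hm⟩ := exists_norm_le_one_sub_nodeGap (mem_ball_zero_iff.1 hz)
  obtain ⟨u, hu, hb⟩ := exists_summable_bound hφ hw m
  exact (hu.of_norm_bounded fun n => hb n z hm).hasSum

/-- The increments telescope from stage `0`, which is zero. Bounds and linearity thus pass from the
stages to the limit. -/
theorem tendsto_interpStage (hφ : ∀ n, ‖φ n‖ ≤ 1) (hw : ∀ n, ‖w n‖ ≤ C) {z : E}
    (hz : z ∈ ball (0 : E) 1) :
    Tendsto (fun n => interpStage φ w n z) atTop (𝓝 (interp φ w z)) := by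
  refine (hasSum_interp hφ hw hz).tendsto_sum_nat.congr fun n => ?_
  rw [Finset.sum_range_sub (fun n => interpStage φ w n z)]
  simp [interpStage]

theorem differentiableOn_interp (hφ : ∀ n, ‖φ n‖ ≤ 1) (hw : ∀ n, ‖w n‖ ≤ C) :
    DifferentiableOn ℂ (interp φ w) (ball (0 : E) 1) := by
  intro z hz
  obtain ⟨s, hzs, hs⟩ := exists_between (mem_ball_zero_iff.1 hz)
  obtain ⟨m, hm⟩ := exists_norm_le_one_sub_nodeGap hs
  obtain ⟨u, hu, hb⟩ := exists_summable_bound hφ hw m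
  have hsub : ∀ y ∈ ball z (s - ‖z‖), ‖y‖ ≤ s := by
    intro y hy
    rw [mem_ball, dist_eq_norm] at hy
    have := norm_le_norm_add_norm_sub' y z
    linarith
  refine (differentiableAt_tsum_of_bound_on_ball (sub_pos.2 hzs) hu (fun n => ?_)
    fun n y hy => hb n y ((hsub y hy).trans hm)).differentiableWithinAt
  refine ((differentiableOn_interpStage hφ w (n + 1)).sub
    (differentiableOn_interpStage hφ w n)).mono fun y hy => ?_
  exact mem_ball_zero_iff.2 ((hsub y hy).trans_lt hs)

theorem norm_interp_le (hφ : ∀ n, ‖φ n‖ ≤ 1) (hw : ∀ n, ‖w n‖ ≤ C) {z : E}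
    (hz : z ∈ ball (0 : E) 1) : ‖interp φ w z‖ ≤ C :=
  le_of_tendsto (tendsto_interpStage hφ hw hz).norm
    (Eventually.of_forall fun n => norm_interpStage_le hφ hw n hz)

theorem interpStage_add (w w' : ℕ → ℂ) (n : ℕ) (z : E) :
    interpStage φ (w + w') n z = interpStage φ w n z + interpStage φ w' n z := by
  induction n with
  | zero => simp [interpStage]
  | succ n ih => simp only [interpStage, ih, Pi.add_apply]; ring

theorem interpStage_smul (c : ℂ) (w : ℕ → ℂ) (n : ℕ) (z : E) :
    interpStage φ (c • w) n z = c * interpStage φ w n z := by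
  induction n with
  | zero => simp [interpStage]
  | succ n ih => simp only [interpStage, ih, Pi.smul_apply, smul_eq_mul]; ring

theorem interp_add {C' : ℝ} {w' : ℕ → ℂ} (hφ : ∀ n, ‖φ n‖ ≤ 1) (hw : ∀ n, ‖w n‖ ≤ C)
    (hw' : ∀ n, ‖w' n‖ ≤ C') {z : E} (hz : z ∈ ball (0 : E) 1) :
    interp φ (w + w') z = interp φ w z + interp φ w' z := by
  have h : ∀ n, ‖(w + w') n‖ ≤ C + C' := fun n =>
    (norm_add_le _ _).trans (add_le_add (hw n) (hw' n))
  refine tendsto_nhds_unique (tendsto_interpStage hφ h hz) ?_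
  simp only [interpStage_add]
  exact (tendsto_interpStage hφ hw hz).add (tendsto_interpStage hφ hw' hz)

theorem interp_smul (hφ : ∀ n, ‖φ n‖ ≤ 1) (hw : ∀ n, ‖w n‖ ≤ C) (c : ℂ) {z : E}
    (hz : z ∈ ball (0 : E) 1) : interp φ (c • w) z = c * interp φ w z := by
  have h : ∀ n, ‖(c • w) n‖ ≤ ‖c‖ * C := fun n => by
    rw [Pi.smul_apply, norm_smul]
    gcongr
    exact hw n
  refine tendsto_nhds_unique (tendsto_interpStage hφ h hz) ?_
  simp only [interpStage_smul]
  exact (tendsto_interpStage hφ hw hz).const_mul c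

/-- Stage `n + 1` nearly replaces the old value by `w n`, because the peak is nearly `1` there; all
later increments are geometrically small. -/
theorem norm_interp_node_sub_le (hφ : ∀ n, ‖φ n‖ ≤ 1) (hw : ∀ n, ‖w n‖ ≤ C) {n : ℕ} {z : E}
    (hz : ‖z‖ ≤ 1 - nodeGap n) (hφz : φ n z = ((1 - nodeGap n : ℝ) : ℂ)) :
    ‖interp φ w z - w n‖ ≤ 7 * C * (1 / 2) ^ n := by
  have hC : 0 ≤ C := (norm_nonneg _).trans (hw 0)
  have hz1 : z ∈ ball (0 : E) 1 := mem_ball_zero_iff.2 (by linarith [nodeGap_pos n])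
  set p := (1 / 2 : ℝ) ^ n with hp
  have hp0 : 0 ≤ p := by positivity
  have htail : ‖interpStage φ w (n + 1) z - interp φ w z‖ ≤ 4 * C * p := by
    have hlim := (tendsto_add_atTop_iff_nat (n + 1)).2 (tendsto_interpStage hφ hw hz1)
    have := dist_le_of_le_geometric_of_tendsto (1 / 2) (4 * C * (p / 4)) (by norm_num)
      (fun k => ?_) hlim 0
    · rw [dist_eq_norm] at this
      simp only [zero_add] at this
      refine this.trans ?_
      have : 0 ≤ C * p := by positivity
      norm_num
      linarith
    · rw [dist_comm, dist_eq_norm]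
      have h := norm_interpStage_succ_sub_le_geometric hφ hw
        (show n < k + (n + 1) by omega) hz
      rw [show k + 1 + (n + 1) = k + (n + 1) + 1 by ring]
      refine h.trans_eq ?_
      rw [hp]
      ring
  have h1 := norm_one_sub_peak_node_le hφz
  have h1' := norm_one_sub_peak_le_one (hφ n) n hz1
  have h2 := norm_peak_le_one (hφ n) n hz1
  have hstage : ‖interpStage φ w (n + 1) z - w n‖ ≤ 3 * C * p := by
    -- Since `p² - 1 = -(1 - p)(1 + p)`, the small factor `1 - p` comes out of the whole error.
    have e : interpStage φ w (n + 1) z - w n = (1 - peak (φ n) n z) *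
        ((1 - peak (φ n) n z) * interpStage φ w n z - w n * (1 + peak (φ n) n z)) := by
      rw [interpStage]; ring
    rw [e, norm_mul, mul_comm]
    gcongr
    refine (norm_sub_le _ _).trans ?_
    rw [norm_mul, norm_mul]
    have h3 : ‖1 + peak (φ n) n z‖ ≤ 2 := by
      refine (norm_add_le _ _).trans ?_
      rw [norm_one]
      linarith
    calc _ ≤ 1 * C + C * 2 := by
          gcongr
          · exact norm_interpStage_le hφ hw n hz1
          · exact hw n
      _ = 3 * C := by ring
  calc ‖interp φ w z - w n‖
      = ‖(interpStage φ w (n + 1) z - w n) - (interpStage φ w (n + 1) z - interp φ w z)‖ := by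
        congr 1; ring
    _ ≤ 3 * C * p + 4 * C * p := (norm_sub_le _ _).trans (add_le_add hstage htail)
    _ = 7 * C * p := by ring

end Peak

/-! ### Independence of the identity and exponentials -/

/-- The value at `z` of the family consisting of the identity and the exponentials
`z ↦ exp (b i * z)`. -/
def expFamily {ι : Type*} (b : ι → ℝ) (z : ℂ) (o : Option ι) : ℂ :=
  o.elim z fun i => Complex.exp (b i * z)

theorem pow_mul_exp_isLittleO {k k' : ℕ} {a a' : ℝ} (h : toLex (a', k') < toLex (a, k)) :
    (fun x : ℝ => x ^ k' * Real.exp (a' * x)) =o[atTop] fun x : ℝ => x ^ k * Real.exp (a * x) := by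
  rcases Prod.Lex.toLex_lt_toLex.1 h with h | ⟨h, hk⟩
  · have h1 : (fun x : ℝ => x ^ k' * Real.exp (a' * x)) =o[atTop]
        fun x : ℝ => Real.exp ((a - a') * x) * Real.exp (a' * x) :=
      (isLittleO_pow_exp_pos_mul_atTop k' (sub_pos.2 h)).mul_isBigO (Asymptotics.isBigO_refl _ _)
    refine h1.trans_isBigO (Asymptotics.IsBigO.of_bound 1 ?_)
    filter_upwards [eventually_ge_atTop (1 : ℝ)] with x hx
    rw [← Real.exp_add, ← add_mul, sub_add_cancel, one_mul, norm_mul]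
    refine le_mul_of_one_le_left (norm_nonneg _) ?_
    rw [norm_pow, Real.norm_of_nonneg (by linarith)]
    exact one_le_pow₀ hx
  · have h' : a' = a := h
    subst h'
    exact (Asymptotics.isLittleO_pow_pow_atTop_of_lt hk).mul_isBigO (Asymptotics.isBigO_refl _ _)

theorem prod_expFamily {ι : Type*} (b : ι → ℝ) (m : Option ι →₀ ℕ) (x : ℝ) :
    (∏ o ∈ m.support, expFamily b x o ^ m o) =
      ((x ^ m none * Real.exp (Finsupp.linearCombination ℕ b m.some * x) : ℝ) : ℂ) := by
  change (m.prod fun o k => expFamily b x o ^ k) = _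
  rw [Finsupp.prod_option_index _ _ (fun _ => pow_zero _) fun _ _ _ => pow_add _ _ _]
  simp only [expFamily, Option.elim, Finsupp.linearCombination_apply, Finsupp.prod, Finsupp.sum,
    Finset.sum_mul, Real.exp_sum]
  push_cast
  congr 1
  refine Finset.prod_congr rfl fun i _ => ?_
  rw [← Complex.exp_nat_mul]
  congr 1
  simp
  ring

/-- The identity and the exponentials with `ℚ`-linearly independent real frequencies satisfy no
polynomial relation. -/
theorem eq_zero_of_aeval_expFamily {ι : Type*} {b : ι → ℝ} (hb : LinearIndependent ℚ b)
    {P : MvPolynomial (Option ι) ℂ} (h : ∀ z : ℂ, MvPolynomial.aeval (expFamily b z) P = 0) :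
    P = 0 := by
  classical
  by_contra hP
  -- Exponents are natural numbers, so distinct exponent vectors on the exponentials give distinct
  -- real frequencies.
  have hbN : LinearIndependent ℕ b :=
    hb.restrict_scalars (R := ℕ) fun m n h => by simpa using h
  -- The dominant monomial at `+∞`: highest frequency first, then highest power of `x`.
  obtain ⟨m, hm, hmax⟩ := Finset.exists_max_image P.support
    (fun m => toLex (Finsupp.linearCombination ℕ b m.some, m none))
    (MvPolynomial.support_nonempty.2 hP)
  let τ : (Option ι →₀ ℕ) → ℝ → ℝ := fun m x =>
    x ^ m none * Real.exp (Finsupp.linearCombination ℕ b m.some * x)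
  have hlt : ∀ m' ∈ P.support.erase m, τ m' =o[atTop] τ m := by
    intro m' hm'
    obtain ⟨hne, hmem⟩ := Finset.mem_erase.1 hm'
    refine pow_mul_exp_isLittleO (lt_of_le_of_ne (hmax m' hmem) fun heq => hne ?_)
    have heq' := toLex_inj.1 heq
    rw [Prod.mk.injEq] at heq'
    have hsome : m'.some = m.some := hbN heq'.1
    ext o
    cases o with
    | none => exact heq'.2
    | some i => simpa using DFunLike.congr_fun hsome i
  have hsum : ∀ x : ℝ, ∑ m' ∈ P.support, P.coeff m' * (τ m' x : ℂ) = 0 := by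
    intro x
    have := h x
    rw [MvPolynomial.aeval_def, MvPolynomial.eval₂_eq] at this
    simpa only [prod_expFamily, Algebra.algebraMap_self, RingHom.id_apply] using this
  have hlead : (fun x : ℝ => P.coeff m * (τ m x : ℂ)) =o[atTop] τ m := by
    have : (fun x : ℝ => P.coeff m * (τ m x : ℂ)) =
        fun x => -∑ m' ∈ P.support.erase m, P.coeff m' * (τ m' x : ℂ) := by
      funext x
      rw [eq_neg_iff_add_eq_zero]
      exact (Finset.add_sum_erase _ (fun m' => P.coeff m' * (τ m' x : ℂ)) hm).trans (hsum x)
    rw [this]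
    refine (Asymptotics.IsLittleO.fun_sum fun m' hm' => ?_).neg_left
    exact (Complex.isLittleO_ofReal_left.2 (hlt m' hm')).const_mul_left _
  have hc : P.coeff m ≠ 0 := MvPolynomial.mem_support_iff.1 hm
  -- The relation makes the dominant term negligible against itself, impossible as it is nonzero for
  -- `x > 0`.
  have hself : τ m =o[atTop] τ m :=
    Complex.isLittleO_ofReal_left.1 ((Asymptotics.isLittleO_const_mul_left_iff hc).1 hlead)
  refine Asymptotics.isLittleO_irrefl' (Eventually.frequently ?_) hself
  filter_upwards [eventually_gt_atTop (0 : ℝ)] with x hx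
  exact norm_ne_zero_iff.2 (by positivity)

theorem differentiable_aeval_expFamily {ι : Type*} (b : ι → ℝ) (P : MvPolynomial (Option ι) ℂ) :
    Differentiable ℂ fun z : ℂ => MvPolynomial.aeval (expFamily b z) P := by
  have hfam : ∀ o, Differentiable ℂ fun z : ℂ => expFamily b z o := by
    intro o
    cases o with
    | none => exact differentiable_id
    | some i => exact (differentiable_id.const_mul _).cexp
  induction P using MvPolynomial.induction_on with
  | C a => simp
  | add p q hp hq => simpa only [map_add] using hp.fun_add hq
  | mul_X p o hp => simpa only [map_mul, MvPolynomial.aeval_X] using hp.fun_mul (hfam o)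

/-! ### Algebras generated by entire functions of one element -/

section Algebra

variable {E : Type*} [NormedAddCommGroup E] [NormedSpace ℂ E]

/-- The composition of a function in `H^∞(B)` with an entire function. -/
def HInfty.entireComp (Φ : ℂ → ℂ) (hΦ : Differentiable ℂ Φ) (f : HInfty E) : HInfty E :=
  ⟨BoundedContinuousFunction.ofNormedAddCommGroup
      (fun x => Φ ((f : ball (0 : E) 1 →ᵇ ℂ) x))
      (hΦ.continuous.comp (f : ball (0 : E) 1 →ᵇ ℂ).continuous)
      (((isCompact_closedBall (0 : ℂ) ‖(f : ball (0 : E) 1 →ᵇ ℂ)‖).exists_bound_of_continuousOn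
        hΦ.continuous.continuousOn).choose)
      fun x => ((isCompact_closedBall (0 : ℂ)
        ‖(f : ball (0 : E) 1 →ᵇ ℂ)‖).exists_bound_of_continuousOn
        hΦ.continuous.continuousOn).choose_spec _
        (mem_closedBall_zero_iff.2 ((f : ball (0 : E) 1 →ᵇ ℂ).norm_coe_le_norm x)),
    by
      obtain ⟨F, hF, hf⟩ := f.2
      exact ⟨fun x => Φ (F x), hΦ.comp_differentiableOn hF, fun x => by simp [hf]⟩⟩

@[simp]
theorem HInfty.entireComp_apply (Φ : ℂ → ℂ) (hΦ : Differentiable ℂ Φ) (f : HInfty E)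
    (x : ball (0 : E) 1) : (HInfty.entireComp Φ hΦ f : ball (0 : E) 1 →ᵇ ℂ) x =
      Φ ((f : ball (0 : E) 1 →ᵇ ℂ) x) := rfl

/-- Cluster values of `f` are mapped to cluster values of `Φ ∘ f`. -/
theorem map_mem_radialClusterSet {Φ : ℂ → ℂ} (hΦ : Continuous Φ) {f g : HInfty E}
    (hg : ∀ x, (g : ball (0 : E) 1 →ᵇ ℂ) x = Φ ((f : ball (0 : E) 1 →ᵇ ℂ) x))
    {x : sphere (0 : E) 1} {μ : ℂ} (hμ : μ ∈ radialClusterSet f x) :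
    Φ μ ∈ radialClusterSet g x := by
  obtain ⟨t, ht, hlim⟩ := hμ
  refine ⟨t, ht, ?_⟩
  simp only [hg]
  exact (hΦ.tendsto μ).comp hlim

/-- A non-constant entire function of a function with large cluster sets has large cluster sets. -/
theorem mem_largeClusterFunctions_of_comp {M : Set (sphere (0 : E) 1)} {Φ : ℂ → ℂ}
    (hΦ : Differentiable ℂ Φ) (hnc : ¬ ∃ w, ∀ z, Φ z = w) {f g : HInfty E}
    (hg : ∀ x, (g : ball (0 : E) 1 →ᵇ ℂ) x = Φ ((f : ball (0 : E) 1 →ᵇ ℂ) x))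
    (hf : f ∈ largeClusterFunctions M) : g ∈ largeClusterFunctions M := by
  obtain ⟨c, r, hr, hsub⟩ := hf
  have hopen : IsOpen (Φ '' ball c r) := by
    rcases (hΦ.differentiableOn.analyticOnNhd isOpen_univ).is_constant_or_isOpen
      isPreconnected_univ with ⟨w, hw⟩ | h
    · exact absurd ⟨w, fun z => hw z trivial⟩ hnc
    · exact h _ (Set.subset_univ _) isOpen_ball
  obtain ⟨s, hs, hball⟩ := nhds_basis_closedBall.mem_iff.1
    (hopen.mem_nhds (Set.mem_image_of_mem Φ (mem_ball_self hr)))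
  refine ⟨Φ c, s, hs, fun μ hμ => ?_⟩
  obtain ⟨ν, hν, rfl⟩ := hball hμ
  have hν' := hsub (ball_subset_closedBall hν)
  simp only [Set.mem_iInter] at hν' ⊢
  exact fun z hz => map_mem_radialClusterSet hΦ.continuous hg (hν' z hz)

/-- An element of the non-unital subalgebra generated by a family is a polynomial without constant
term in the members of the family. -/
theorem exists_aeval_eq_of_mem_adjoin_range {A ι : Type*} [CommRing A] [Algebra ℂ A] (v : ι → A)
    {a : A} (ha : a ∈ NonUnitalAlgebra.adjoin ℂ (Set.range v)) :
    ∃ P : MvPolynomial ι ℂ, MvPolynomial.constantCoeff P = 0 ∧ MvPolynomial.aeval v P = a := by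
  induction ha using NonUnitalAlgebra.adjoin_induction with
  | mem x hx =>
    obtain ⟨i, rfl⟩ := hx
    exact ⟨MvPolynomial.X i, by simp, by simp⟩
  | add x y _ _ hx hy =>
    obtain ⟨P, hP, rfl⟩ := hx
    obtain ⟨Q, hQ, rfl⟩ := hy
    exact ⟨P + Q, by simp [hP, hQ], by simp⟩
  | zero => exact ⟨0, by simp, by simp⟩
  | mul x y _ _ hx hy =>
    obtain ⟨P, hP, rfl⟩ := hx
    obtain ⟨Q, hQ, rfl⟩ := hy
    exact ⟨P * Q, by simp [hP], by simp⟩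
  | smul c x _ hx =>
    obtain ⟨P, hP, rfl⟩ := hx
    exact ⟨c • P, by simp [hP], by simp⟩

/-- The family consisting of `f` and the functions `exp (b i * f)`. -/
def HInfty.expFamily {ι : Type*} (b : ι → ℝ) (f : HInfty E) (o : Option ι) : HInfty E :=
  HInfty.entireComp (fun z => MvPolynomial.aeval (_root_.expFamily b z) (MvPolynomial.X o))
    (differentiable_aeval_expFamily b (MvPolynomial.X o)) f

theorem HInfty.expFamily_none {ι : Type*} (b : ι → ℝ) (f : HInfty E) :
    HInfty.expFamily b f none = f := by
  refine Subtype.ext (BoundedContinuousFunction.ext fun x => ?_)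
  simp [HInfty.expFamily, _root_.expFamily]

theorem HInfty.aeval_expFamily_apply {ι : Type*} (b : ι → ℝ) (f : HInfty E)
    (P : MvPolynomial (Option ι) ℂ) (x : ball (0 : E) 1) :
    (MvPolynomial.aeval (HInfty.expFamily b f) P : ball (0 : E) 1 →ᵇ ℂ) x =
      MvPolynomial.aeval (_root_.expFamily b ((f : ball (0 : E) 1 →ᵇ ℂ) x)) P := by
  induction P using MvPolynomial.induction_on with
  | C a => simp
  | add p q hp hq => simp [hp, hq]
  | mul_X p o hp => simp [hp, HInfty.expFamily]

/-- An entire function which vanishes on a disc vanishes identically. -/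
theorem eq_zero_of_forall_mem_closedBall {Φ : ℂ → ℂ} (hΦ : Differentiable ℂ Φ) {c : ℂ} {r : ℝ}
    (hr : 0 < r) (h : ∀ z ∈ closedBall c r, Φ z = 0) (z : ℂ) : Φ z = 0 := by
  have h1 : AnalyticOnNhd ℂ Φ Set.univ := hΦ.differentiableOn.analyticOnNhd isOpen_univ
  have h2 : Φ =ᶠ[𝓝 c] 0 := by
    filter_upwards [closedBall_mem_nhds c hr] with z hz using h z hz
  exact h1.eqOn_zero_of_preconnected_of_eventuallyEq_zero isPreconnected_univ
    (Set.mem_univ c) h2 (Set.mem_univ z)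

/-- A relation says that an entire function vanishes on the values of `f`, hence on the disc of
cluster values at one point of `M`, hence everywhere. -/
theorem HInfty.algebraicIndependent_expFamily {ι : Type*} {b : ι → ℝ}
    (hb : LinearIndependent ℚ b) {M : Set (sphere (0 : E) 1)} (hM : M.Nonempty) {f : HInfty E}
    (hf : f ∈ largeClusterFunctions M) : AlgebraicIndependent ℂ (HInfty.expFamily b f) := by
  rw [algebraicIndependent_iff]
  intro P hP
  obtain ⟨c, r, hr, hsub⟩ := hf
  obtain ⟨x, hx⟩ := hM
  refine eq_zero_of_aeval_expFamily hb (eq_zero_of_forall_mem_closedBall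
    (differentiable_aeval_expFamily b P) (c := c) hr fun z hz => ?_)
  have hz' : z ∈ radialClusterSet f x := by
    have := hsub hz
    simp only [Set.mem_iInter] at this
    exact this x hx
  obtain ⟨t, -, ht⟩ := map_mem_radialClusterSet
    (differentiable_aeval_expFamily b P).continuous (HInfty.aeval_expFamily_apply b f P) hz'
  rw [hP] at ht
  exact tendsto_nhds_unique ht tendsto_const_nhds

theorem HInfty.adjoin_expFamily_subset {ι : Type*} {b : ι → ℝ}
    (hb : LinearIndependent ℚ b) {M : Set (sphere (0 : E) 1)} {f : HInfty E}
    (hf : f ∈ largeClusterFunctions M) :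
    (NonUnitalAlgebra.adjoin ℂ (Set.range (HInfty.expFamily b f)) : Set (HInfty E)) ⊆
      largeClusterFunctions M ∪ {0} := by
  intro g hg
  obtain ⟨P, hP0, rfl⟩ := exists_aeval_eq_of_mem_adjoin_range _ hg
  by_cases hc : ∃ w, ∀ z, MvPolynomial.aeval (_root_.expFamily b z) P = w
  · right
    obtain ⟨w, hw⟩ := hc
    -- A constant value makes `P` itself constant by independence; having no constant term, it is
    -- zero.
    have hPw : P - MvPolynomial.C w = 0 := eq_zero_of_aeval_expFamily hb fun z => by
      rw [map_sub, hw z, MvPolynomial.aeval_C, Algebra.algebraMap_self, RingHom.id_apply, sub_self]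
    have hPw' : P = MvPolynomial.C w := sub_eq_zero.1 hPw
    rw [hPw', MvPolynomial.constantCoeff_C] at hP0
    rw [hPw', hP0, map_zero, map_zero]
    rfl
  · left
    exact mem_largeClusterFunctions_of_comp (differentiable_aeval_expFamily b P) hc
      (HInfty.aeval_expFamily_apply b f P) hf

theorem exists_generators_of_mem_largeClusterFunctions {M : Set (sphere (0 : E) 1)}
    (hM : M.Nonempty) {f : HInfty E} (hf : f ∈ largeClusterFunctions M) :
    ∃ G : Set (HInfty E), #G = 𝔠 ∧ AlgebraicIndependent ℂ ((↑) : G → HInfty E) ∧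
      f ∈ NonUnitalAlgebra.adjoin ℂ G ∧
      (NonUnitalAlgebra.adjoin ℂ G : Set (HInfty E)) ⊆ largeClusterFunctions M ∪ {0} := by
  let b := Module.Basis.ofVectorSpace ℚ ℝ
  have hind := HInfty.algebraicIndependent_expFamily b.linearIndependent hM hf
  refine ⟨Set.range (HInfty.expFamily b f), ?_, hind.coe_range, ?_,
    HInfty.adjoin_expFamily_subset b.linearIndependent hf⟩
  · have h1 : #(Option (Module.Basis.ofVectorSpaceIndex ℚ ℝ)) = 𝔠 := by
      rw [mk_option, b.mk_eq_rank'', Real.rank_rat_real]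
      exact add_one_eq aleph0_le_continuum
    have h2 := mk_range_eq_of_injective hind.injective
    rwa [h1, lift_continuum, lift_uzero] at h2
  · exact NonUnitalAlgebra.subset_adjoin ℂ ⟨none, HInfty.expFamily_none _ f⟩

end Algebra

/-! ### Pairings of `ℓ₁` with sequences in the unit disc -/

section EllOne

theorem hasSum_norm_ellOne (a : lp (fun _ : ℕ => ℂ) 1) : HasSum (fun j => ‖a j‖) ‖a‖ := by
  simpa using lp.hasSum_norm (p := 1) (by simp) a

theorem norm_ellOne_term_le (a : lp (fun _ : ℕ => ℂ) 1) (j : ℕ) (v : closedBall (0 : ℂ) 1) :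
    ‖a j * (v : ℂ)‖ ≤ ‖a j‖ := by
  rw [norm_mul]
  exact mul_le_of_le_one_right (norm_nonneg _) (mem_closedBall_zero_iff.1 v.2)

/-- The pairing of `a ∈ ℓ₁` with a sequence in the closed unit disc. -/
def ellOnePairing (a : lp (fun _ : ℕ => ℂ) 1) (v : ℕ → closedBall (0 : ℂ) 1) : ℂ :=
  ∑' j, a j * (v j : ℂ)

theorem summable_ellOnePairing (a : lp (fun _ : ℕ => ℂ) 1) (v : ℕ → closedBall (0 : ℂ) 1) :
    Summable fun j => a j * (v j : ℂ) :=
  (hasSum_norm_ellOne a).summable.of_norm_bounded fun j => norm_ellOne_term_le a j (v j)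

theorem norm_ellOnePairing_le (a : lp (fun _ : ℕ => ℂ) 1) (v : ℕ → closedBall (0 : ℂ) 1) :
    ‖ellOnePairing a v‖ ≤ ‖a‖ :=
  tsum_of_norm_bounded (hasSum_norm_ellOne a) fun j => norm_ellOne_term_le a j (v j)

theorem ellOnePairing_add (a b : lp (fun _ : ℕ => ℂ) 1) (v : ℕ → closedBall (0 : ℂ) 1) :
    ellOnePairing (a + b) v = ellOnePairing a v + ellOnePairing b v := by
  simp only [ellOnePairing, lp.coeFn_add, Pi.add_apply, add_mul]
  exact (summable_ellOnePairing a v).tsum_add (summable_ellOnePairing b v)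

theorem ellOnePairing_smul (c : ℂ) (a : lp (fun _ : ℕ => ℂ) 1) (v : ℕ → closedBall (0 : ℂ) 1) :
    ellOnePairing (c • a) v = c * ellOnePairing a v := by
  simp only [ellOnePairing, lp.coeFn_smul, Pi.smul_apply, smul_eq_mul, mul_assoc]
  exact tsum_mul_left

/-- Continuity is for the product topology, which is separable; a single dense sequence of test
vectors therefore serves all `a`. -/
theorem continuous_ellOnePairing (a : lp (fun _ : ℕ => ℂ) 1) : Continuous (ellOnePairing a) :=
  continuous_tsum (fun j => by fun_prop) (hasSum_norm_ellOne a).summable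
    fun j v => norm_ellOne_term_le a j (v j)

/-- The pairings with sequences in the closed unit disc fill the disc of radius `‖a‖`. -/
theorem exists_ellOnePairing_eq (a : lp (fun _ : ℕ => ℂ) 1) {μ : ℂ} (hμ : ‖μ‖ ≤ ‖a‖) :
    ∃ v, ellOnePairing a v = μ := by
  have hu : ‖μ / ‖a‖‖ ≤ 1 := by
    rw [norm_div, Complex.norm_real, norm_norm]
    exact div_le_one_of_le₀ hμ (norm_nonneg _)
  have hs : ∀ j, ‖(starRingEnd ℂ) (a j) / ‖a j‖‖ ≤ 1 := fun j => by
    rw [norm_div, Complex.norm_real, norm_norm, RCLike.norm_conj]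
    exact div_self_le_one _
  -- Align the phases and rescale. Division by zero gives `0`, harmless when `a j = 0`, and when `a
  -- = 0` because then `μ = 0`.
  refine ⟨fun j => ⟨μ / ‖a‖ * ((starRingEnd ℂ) (a j) / ‖a j‖), mem_closedBall_zero_iff.2 ?_⟩, ?_⟩
  · rw [norm_mul]
    exact mul_le_one₀ hu (norm_nonneg _) (hs j)
  · have hterm : ∀ j, a j * (μ / ‖a‖ * ((starRingEnd ℂ) (a j) / ‖a j‖)) =
        μ / ‖a‖ * ((‖a j‖ : ℝ) : ℂ) := by
      intro j
      rcases eq_or_ne (a j) 0 with h | h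
      · simp [h]
      · have h' : ((‖a j‖ : ℝ) : ℂ) ≠ 0 := Complex.ofReal_ne_zero.2 (norm_ne_zero_iff.2 h)
        have h2 := Complex.mul_conj' (a j)
        field_simp
        rw [mul_right_comm, h2]
        ring
    simp only [ellOnePairing, hterm]
    rw [tsum_mul_left, ← Complex.ofReal_tsum, (hasSum_norm_ellOne a).tsum_eq]
    rcases eq_or_ne a 0 with h | h
    · have : μ = 0 := by simpa [h] using hμ
      simp [this]
    · exact div_mul_cancel₀ _ (Complex.ofReal_ne_zero.2 (norm_ne_zero_iff.2 h))

theorem not_finiteDimensional_ellOne : ¬ FiniteDimensional ℂ (lp (fun _ : ℕ => ℂ) 1) := by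
  intro h
  have hli : LinearIndependent ℂ fun n : ℕ =>
      (lp.single 1 n (1 : ℂ) : lp (fun _ : ℕ => ℂ) 1) := by
    let L : lp (fun _ : ℕ => ℂ) 1 →ₗ[ℂ] (ℕ → ℂ) :=
      { toFun := fun a => a, map_add' := fun _ _ => rfl, map_smul' := fun _ _ => rfl }
    refine LinearIndependent.of_comp L ?_
    convert Pi.linearIndependent_single_one ℕ ℂ using 1
    funext n
    exact lp.coeFn_single (E := fun _ : ℕ => ℂ) 1 n 1
  exact not_finite_iff_infinite.2 (inferInstance : Infinite ℕ) hli.finite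

/-- The range of a linear isometry of `ℓ₁` witnesses that a set contains a copy of `ℓ₁` and is
spaceable. -/
theorem containsCopyOfEllOne_and_spaceable {V : Type*} [NormedAddCommGroup V] [NormedSpace ℂ V]
    {C : Set V} (T : lp (fun _ : ℕ => ℂ) 1 →ₗᵢ[ℂ] V) (hT : ∀ a, a ≠ 0 → T a ∈ C) :
    ContainsCopyOfEllOne C ∧ Spaceable C := by
  have hsub : (LinearMap.range T.toLinearMap : Set V) ⊆ C ∪ {0} := by
    rintro _ ⟨a, rfl⟩
    rcases eq_or_ne a 0 with rfl | ha
    · right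
      exact map_zero T
    · exact Or.inl (hT a ha)
  exact ⟨⟨_, ⟨T.equivRange.toContinuousLinearEquiv⟩, hsub⟩,
    ⟨_, T.isometry.isClosedEmbedding.isClosed_range, fun _ => not_finiteDimensional_ellOne
      (LinearEquiv.ofInjective T.toLinearMap T.injective).symm.finiteDimensional, hsub⟩⟩

end EllOne

/-! ### The isometric embedding of `ℓ₁` -/

section Embedding

variable {E : Type*} [NormedAddCommGroup E] [NormedSpace ℂ E]

theorem mem_radialClusterSet_of_forall_exists {f : HInfty E} {x : sphere (0 : E) 1} {μ : ℂ}
    (h : ∀ ε > 0, ∃ t : Set.Ioo (0 : ℝ) 1, 1 - (t : ℝ) < ε ∧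
      ‖(f : ball (0 : E) 1 →ᵇ ℂ) (radialPoint x t) - μ‖ < ε) : μ ∈ radialClusterSet f x := by
  choose t ht hft using fun n : ℕ => h (1 / ((n : ℝ) + 1)) (by positivity)
  refine ⟨t, ?_, ?_⟩
  · rw [tendsto_iff_norm_sub_tendsto_zero]
    refine squeeze_zero (fun _ => norm_nonneg _) (fun n => ?_)
      tendsto_one_div_add_atTop_nhds_zero_nat
    rw [norm_sub_rev, Real.norm_of_nonneg (sub_nonneg.2 (t n).2.2.le)]
    exact (ht n).le
  · rw [tendsto_iff_norm_sub_tendsto_zero]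
    exact squeeze_zero (fun _ => norm_nonneg _) (fun n => (hft n).le)
      tendsto_one_div_add_atTop_nhds_zero_nat

theorem norm_le_of_mem_radialClusterSet {f : HInfty E} {x : sphere (0 : E) 1} {μ : ℂ}
    (h : μ ∈ radialClusterSet f x) : ‖μ‖ ≤ ‖f‖ := by
  obtain ⟨t, -, ht⟩ := h
  exact le_of_tendsto ht.norm (Eventually.of_forall fun k =>
    (f : ball (0 : E) 1 →ᵇ ℂ).norm_coe_le_norm _)

/-- The interpolating function as an element of `H^∞(B)`. -/
def interpHInfty {φ : ℕ → E →L[ℂ] ℂ} (hφ : ∀ n, ‖φ n‖ ≤ 1) {w : ℕ → ℂ} {C : ℝ}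
    (hw : ∀ n, ‖w n‖ ≤ C) : HInfty E :=
  ⟨BoundedContinuousFunction.ofNormedAddCommGroup (fun z : ball (0 : E) 1 => interp φ w z)
      (continuousOn_iff_continuous_domRestrict.1 (differentiableOn_interp hφ hw).continuousOn) C
      fun z => norm_interp_le hφ hw z.2,
    interp φ w, differentiableOn_interp hφ hw, fun _ => rfl⟩

theorem norm_interpHInfty_le {φ : ℕ → E →L[ℂ] ℂ} (hφ : ∀ n, ‖φ n‖ ≤ 1) {w : ℕ → ℂ} {C : ℝ}
    (hw : ∀ n, ‖w n‖ ≤ C) : ‖interpHInfty hφ hw‖ ≤ C :=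
  BoundedContinuousFunction.norm_ofNormedAddCommGroup_le _
    ((norm_nonneg _).trans (hw 0)) fun z => norm_interp_le hφ hw z.2

/-- The linear map `ℓ₁ → H^∞(B)` sending `a` to a function that interpolates the pairings of `a`
with the sequences `v n`. -/
def ellOneInterp {φ : ℕ → E →L[ℂ] ℂ} (hφ : ∀ n, ‖φ n‖ ≤ 1) (v : ℕ → ℕ → closedBall (0 : ℂ) 1) :
    lp (fun _ : ℕ => ℂ) 1 →ₗ[ℂ] HInfty E where
  toFun a := interpHInfty hφ fun n => norm_ellOnePairing_le a (v n)
  map_add' a b := by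
    refine Subtype.ext (BoundedContinuousFunction.ext fun z => ?_)
    have h : (fun n => ellOnePairing (a + b) (v n)) =
        (fun n => ellOnePairing a (v n)) + fun n => ellOnePairing b (v n) :=
      funext fun n => ellOnePairing_add a b (v n)
    change interp φ _ (z : E) = interp φ _ (z : E) + interp φ _ (z : E)
    rw [h]
    exact interp_add hφ (fun n => norm_ellOnePairing_le a (v n))
      (fun n => norm_ellOnePairing_le b (v n)) z.2
  map_smul' c a := by
    refine Subtype.ext (BoundedContinuousFunction.ext fun z => ?_)
    have h : (fun n => ellOnePairing (c • a) (v n)) = c • fun n => ellOnePairing a (v n) :=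
      funext fun n => ellOnePairing_smul c a (v n)
    change interp φ _ (z : E) = c * interp φ _ (z : E)
    rw [h]
    exact interp_smul hφ (fun n => norm_ellOnePairing_le a (v n)) c z.2

theorem ellOneInterp_apply {φ : ℕ → E →L[ℂ] ℂ} (hφ : ∀ n, ‖φ n‖ ≤ 1)
    (v : ℕ → ℕ → closedBall (0 : ℂ) 1) (a : lp (fun _ : ℕ => ℂ) 1) (z : ball (0 : E) 1) :
    (ellOneInterp hφ v a : ball (0 : E) 1 →ᵇ ℂ) z =
      interp φ (fun n => ellOnePairing a (v n)) z := rfl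

theorem exists_norming_functional (x : sphere (0 : E) 1) :
    ∃ ψ : E →L[ℂ] ℂ, ‖ψ‖ ≤ 1 ∧ ψ x = 1 := by
  have hx : ‖(x : E)‖ = 1 := by simp
  obtain ⟨ψ, h1, h2⟩ := exists_dual_vector ℂ (x : E) (by rw [hx]; exact one_ne_zero)
  exact ⟨ψ, h1.le, by rw [h2, hx]; simp⟩

/-- For a countable set `M` of the sphere there is a linear map `ℓ₁ → H^∞(B)` of norm at most `1`
such that the radial cluster set of the image of `a` at each point of `M` contains the disc of
radius `‖a‖`. -/
theorem exists_linearMap_closedBall_subset_radialClusterSet {M : Set (sphere (0 : E) 1)}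
    (hM : M.Countable) (hM' : M.Nonempty) :
    ∃ T : lp (fun _ : ℕ => ℂ) 1 →ₗ[ℂ] HInfty E, (∀ a, ‖T a‖ ≤ ‖a‖) ∧
      ∀ a, ∀ x ∈ M, closedBall 0 ‖a‖ ⊆ radialClusterSet (T a) x := by
  obtain ⟨x, rfl⟩ := hM.exists_eq_range hM'
  choose ψ hψ hψx using exists_norming_functional (E := E)
  -- An index encodes `(N, (m, i))`. The coordinate `N` is ignored, so each point `x m` meets each
  -- test sequence `i` at arbitrarily large indices.
  let node : ℕ → sphere (0 : E) 1 := fun k => x k.unpair.2.unpair.1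
  let v : ℕ → ℕ → closedBall (0 : ℂ) 1 := fun k =>
    TopologicalSpace.denseSeq (ℕ → closedBall (0 : ℂ) 1) k.unpair.2.unpair.2
  have hφ : ∀ k, ‖ψ (node k)‖ ≤ 1 := fun k => hψ _
  refine ⟨ellOneInterp hφ v,
    fun a => norm_interpHInfty_le hφ fun n => norm_ellOnePairing_le a (v n), ?_⟩
  rintro a _ ⟨m, rfl⟩ μ hμ
  refine mem_radialClusterSet_of_forall_exists fun ε hε => ?_
  obtain ⟨u, hu⟩ := exists_ellOnePairing_eq a (mem_closedBall_zero_iff.1 hμ)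
  obtain ⟨i, hi⟩ : ∃ i, ‖ellOnePairing a
      (TopologicalSpace.denseSeq (ℕ → closedBall (0 : ℂ) 1) i) - μ‖ < ε / 2 := by
    have hopen : IsOpen {v | ‖ellOnePairing a v - μ‖ < ε / 2} :=
      isOpen_lt ((continuous_ellOnePairing a).sub continuous_const).norm continuous_const
    have hne : {v | ‖ellOnePairing a v - μ‖ < ε / 2}.Nonempty := ⟨u, by simpa [hu] using hε⟩
    obtain ⟨_, h, ⟨i, rfl⟩⟩ := (TopologicalSpace.denseRange_denseSeq
      (ℕ → closedBall (0 : ℂ) 1)).inter_open_nonempty _ hopen hne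
    exact ⟨i, h⟩
  have hlim : Tendsto (fun k : ℕ => 7 * ‖a‖ * (1 / 2 : ℝ) ^ k) atTop (𝓝 0) := by
    simpa using (tendsto_pow_atTop_nhds_zero_of_lt_one (r := (1 / 2 : ℝ)) (by norm_num)
      (by norm_num)).const_mul (7 * ‖a‖)
  obtain ⟨N, hN⟩ := eventually_atTop.1 ((hlim.eventually (gt_mem_nhds (half_pos hε))).and
    (tendsto_nodeGap.eventually (gt_mem_nhds hε)))
  set k := Nat.pair N (Nat.pair m i) with hk
  obtain ⟨h1, h2⟩ := hN k (Nat.left_le_pair _ _)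
  have hnode : node k = x m := by simp [node, hk]
  have hv : v k = TopologicalSpace.denseSeq (ℕ → closedBall (0 : ℂ) 1) i := by simp [v, hk]
  let t : Set.Ioo (0 : ℝ) 1 :=
    ⟨1 - nodeGap k, sub_pos.2 (nodeGap_lt_one k), sub_lt_self 1 (nodeGap_pos k)⟩
  refine ⟨t, by simpa [t] using h2, ?_⟩
  have hz : ((radialPoint (x m) t : ball (0 : E) 1) : E) =
      ((1 - nodeGap k : ℝ) : ℂ) • (node k : E) := by rw [hnode]; rfl
  have hznorm : ‖((radialPoint (x m) t : ball (0 : E) 1) : E)‖ ≤ 1 - nodeGap k := by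
    rw [hz, norm_smul, Complex.norm_real, Real.norm_of_nonneg t.2.1.le]
    simp [t]
  have hzval : ψ (node k) (radialPoint (x m) t : ball (0 : E) 1) = ((1 - nodeGap k : ℝ) : ℂ) := by
    rw [hz, map_smul, hψx, smul_eq_mul, mul_one]
  have h3 := norm_interp_node_sub_le hφ (fun n => norm_ellOnePairing_le a (v n)) hznorm hzval
  rw [hv] at h3
  rw [ellOneInterp_apply]
  calc _ ≤ _ := norm_sub_le_norm_sub_add_norm_sub _ (ellOnePairing a
        (TopologicalSpace.denseSeq (ℕ → closedBall (0 : ℂ) 1) i)) _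
    _ < ε / 2 + ε / 2 := add_lt_add_of_le_of_lt (h3.trans h1.le) hi
    _ = ε := add_halves ε

/-- An isometric copy of `ℓ₁` consisting, up to `0`, of functions with large cluster sets. -/
theorem exists_linearIsometry_range_subset {M : Set (sphere (0 : E) 1)}
    (hM : M.Countable) (hM' : M.Nonempty) :
    ∃ T : lp (fun _ : ℕ => ℂ) 1 →ₗᵢ[ℂ] HInfty E,
      ∀ a, a ≠ 0 → T a ∈ largeClusterFunctions M := by
  obtain ⟨T, hT, hcl⟩ := exists_linearMap_closedBall_subset_radialClusterSet hM hM'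
  have hnorm : ∀ a, ‖T a‖ = ‖a‖ := by
    intro a
    refine le_antisymm (hT a) ?_
    obtain ⟨x, hx⟩ := hM'
    -- The number `‖a‖` is itself a cluster value of `T a`, which gives the lower bound on the norm.
    have hn : ‖((‖a‖ : ℝ) : ℂ)‖ = ‖a‖ := by rw [Complex.norm_real, norm_norm]
    have h := norm_le_of_mem_radialClusterSet
      (hcl a x hx (mem_closedBall_zero_iff.2 hn.le))
    exact hn.symm.trans_le h
  exact ⟨⟨T, hnorm⟩, fun a ha => ⟨0, ‖a‖, norm_pos_iff.2 ha,
    Set.subset_iInter₂ fun x hx => hcl a x hx⟩⟩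

end Embedding

end

theorem mainTheorem2 {E : Type*} [NormedAddCommGroup E] [NormedSpace ℂ E] [FiniteDimensional ℂ E]
    (M : Set (sphere (0 : E) 1)) (hM : M.Countable) (hM' : M.Nonempty) :
    ContainsCopyOfEllOne (largeClusterFunctions M) ∧
    Spaceable (largeClusterFunctions M) ∧
    PointwiseStronglyAlgebrable 𝔠 (largeClusterFunctions M) ∧
    StronglyAlgebrable 𝔠 (largeClusterFunctions M) := by
  obtain ⟨T, hT⟩ := exists_linearIsometry_range_subset hM hM'
  have hne : (largeClusterFunctions M).Nonempty := by
    refine ⟨T (lp.single 1 0 (1 : ℂ)), hT _ fun h => ?_⟩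
    have := congrArg (fun a : lp (fun _ : ℕ => ℂ) 1 => a 0) h
    simp at this
  obtain ⟨hcopy, hspace⟩ := containsCopyOfEllOne_and_spaceable T hT
  refine ⟨hcopy, hspace,
    ⟨hne, fun f hf => exists_generators_of_mem_largeClusterFunctions hM' hf⟩, ?_⟩
  obtain ⟨f, hf⟩ := hne
  obtain ⟨G, h1, h2, -, h3⟩ := exists_generators_of_mem_largeClusterFunctions hM' hf
  exact ⟨G, h1, h2, h3⟩
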